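/- \textbf{Setting.} Consider a multi-hop amplify-and-forward relay network with $L$ links and $Q\ge 1$ relay clusters: channel matrices $\mathbf H_0^l\in\mathbb C^{L_1\times L_{T_l}}$ (source of link $l$ to cluster $1$), $\mathbf H_q\in\mathbb C^{L_{q+1}\times L_q}$, $1\le q\le Q-1$ (cluster $q$ to cluster $q+1$), $\mathbf H_Q^l\in\mathbb C^{L_{R_l}\times L_Q}$ (cluster $Q$ to the destination of link $l$); noise covariances $\mathbf W_q$ ($1\le q\le Q$), $\mathbf W_{Q+1}^l$; constraint matrices $\hat{\mathbf W}_0^l$, $\hat{\mathbf W}_q$ ($1\le q\le Q$), all these covariance and constraint matrices being positive definite; and a coupling matrix $\Phi=(\phi_{l,k})\in\{0,1\}^{L\times L}$ with $\phi_{l,l}=0$. Let $\mathbf F_q\in\mathbb C^{L_q\times L_q}$ be relay precoding matrices and $\mathbf\Sigma=(\mathbf\Sigma_1,\dots,\mathbf\Sigma_L)\ne 0$ input covariance matrices. Put $\mathbf B_{q,q'}=\mathbf F_{q'}\mathbf H_{q'-1}\mathbf F_{q'-1}\cdots\mathbf H_q\mathbf F_q$ for $q\le q'$, $\check{\mathbf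 H}_{l,k}=\mathbf H_Q^l\mathbf B_{1,Q}\mathbf H_0^k$, and $$\mathbf W'_l=\sum_{q=1}^Q\mathbf H_Q^l\mathbf B_{q,Q}\mathbf W_q\mathbf B_{q,Q}^\dagger\mathbf H_Q^{l\dagger}+\mathbf W_{Q+1}^l,\qquad \mathbf\Sigma_q^R=\sum_{l}\mathbf B_{1,q}\mathbf H_0^l\mathbf\Sigma_l\mathbf H_0^{l\dagger}\mathbf B_{1,q}^\dagger+\sum_{q'=1}^q\mathbf B_{q',q}\mathbf W_{q'}\mathbf B_{q',q}^\dagger,$$ $$P_0^{\rm tx}=\sum_l\mathrm{Tr}(\mathbf\Sigma_l\hat{\mathbf W}_0^l),\qquad P_q^{\rm tx}=\mathrm{Tr}(\mathbf\Sigma_q^R\hat{\mathbf W}_q),\qquad b_{q,q'}=\mathrm{Tr}(\mathbf B_{q,q'}\mathbf W_q\mathbf B_{q,q'}^\dagger\hat{\mathbf W}_{q'})\quad (1\le q\le q'\le Q).$$ \textbf{Covariance transformation.} Let $\mathbf\Sigma_l=\sum_{m=1}^{M_l}p_{l,m}\mathbf t_{l,m}\mathbf t_{l,m}^\dagger$ with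 $p_{l,m}>0$, $\|\mathbf t_{l,m}\|=1$, be any decomposition into streams for which the following receive vectors exist (that is, $\check{\mathbf H}_{l,l}\mathbf t_{l,m}\neq 0$ for all $l,m$): $$\mathbf r_{l,m}=\alpha_{l,m}\Big(\sum_{i>m}p_{l,i}\check{\mathbf H}_{l,l}\mathbf t_{l,i}\mathbf t_{l,i}^\dagger\check{\mathbf H}_{l,l}^\dagger+\mathbf\Omega_l\Big)^{-1}\check{\mathbf H}_{l,l}\mathbf t_{l,m},\quad \|\mathbf r_{l,m}\|=1,\qquad \mathbf\Omega_l=\mathbf W'_l+\sum_k\phi_{l,k}\check{\mathbf H}_{l,k}\mathbf\Sigma_k\check{\mathbf H}_{l,k}^\dagger .$$ Let $\mathbf\Psi$ be the matrix, indexed by streams, whose entry in row $(l,m)$ and column $(k,n)$ is $0$ if $k=l$ and $m\ge n$, $|\mathbf r_{l,m}^\dagger\check{\mathbf H}_{l,l}\mathbf t_{l,n}|^2$ if $k=l$ and $m<n$, and $\phi_{l,k}|\mathbf r_{l,m}^\dagger\check{\mathbf H}_{l,k}\mathbf t_{k,n}|^2$ if $k\ne l$. Let $\gamma_{l,m}=p_{l,m}|\mathbf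 r_{l,m}^\dagger\check{\mathbf H}_{l,l}\mathbf t_{l,m}|^2\big/\big(\sum_{(k,n)}\mathbf\Psi_{(l,m),(k,n)}p_{k,n}+\mathbf r_{l,m}^\dagger\mathbf W'_l\mathbf r_{l,m}\big)$ be the SINR of stream $(l,m)$, and let $\mathbf D$ be the diagonal matrix with entries $\gamma_{l,m}/|\mathbf r_{l,m}^\dagger\check{\mathbf H}_{l,l}\mathbf t_{l,m}|^2$. For $\mathbf d=(d_1,\dots,d_Q,d_{Q+1})$ with $d_{Q+1}=1$ and all $d_q>0$, the scaled dual network has dual noise covariances $d_1\hat{\mathbf W}_0^l$ and $d_{q+1}\hat{\mathbf W}_q$ and relay precoding matrices $\hat{\mathbf F}_q=\mathbf F_q^\dagger$. Put $\hat{\mathbf W}'_l(\mathbf d)=\sum_{q=1}^Qd_{q+1}\mathbf H_0^{l\dagger}\mathbf B_{1,q}^\dagger\hat{\mathbf W}_q\mathbf B_{1,q}\mathbf H_0^l+d_1\hat{\mathbf W}_0^l$, $\hat{\mathbf n}(\mathbf d)=\big(\mathbf t_{l,m}^\dagger\hat{\mathbf W}'_l(\mathbf d)\mathbf t_{l,m}\big)_{l,m}$,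 $\bar{\mathbf q}=(\mathbf D^{-1}-\mathbf\Psi^T)^{-1}\hat{\mathbf n}(\mathbf d)$, and $$\hat{\mathbf\Sigma}_l(\mathbf d)=\sum_m\bar q_{l,m}\mathbf r_{l,m}\mathbf r_{l,m}^\dagger,\qquad \hat{\mathbf\Sigma}_q^R(\mathbf d)=\sum_l\mathbf B_{q,Q}^\dagger\mathbf H_Q^{l\dagger}\hat{\mathbf\Sigma}_l(\mathbf d)\mathbf H_Q^l\mathbf B_{q,Q}+\sum_{q'=q}^Qd_{q'+1}\mathbf B_{q,q'}^\dagger\hat{\mathbf W}_{q'}\mathbf B_{q,q'} .$$ \textbf{The matrix.} For $0\le q,q'\le Q$ let $a_{q,q'}=\mathbf n_q^T(\mathbf D^{-1}-\mathbf\Psi^T)^{-1}\hat{\mathbf n}_{q'}$, where $\mathbf n_{q}$ has entries $\mathbf r_{l,m}^\dagger\mathbf H_Q^l\mathbf B_{q+1,Q}\mathbf W_{q+1}\mathbf B_{q+1,Q}^\dagger\mathbf H_Q^{l\dagger}\mathbf r_{l,m}$ for $q<Q$ and $\mathbf r_{l,m}^\dagger\mathbf W_{Q+1}^l\mathbf r_{l,m}$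 for $q=Q$, and $\hat{\mathbf n}_q$ has entries $\mathbf t_{l,m}^\dagger\hat{\mathbf W}_0^l\mathbf t_{l,m}$ for $q=0$ and $\mathbf t_{l,m}^\dagger\mathbf H_0^{l\dagger}\mathbf B_{1,q}^\dagger\hat{\mathbf W}_q\mathbf B_{1,q}\mathbf H_0^l\mathbf t_{l,m}$ for $q\ge1$. Let $\mathbf A$ be the $(Q+1)\times(Q+1)$ matrix whose $(q,q')$ entry is $(a_{q-1,q'-1}+b_{q,q'-1})/P_{q-1}^{\rm tx}$ if $q'>q$ and $a_{q-1,q'-1}/P_{q-1}^{\rm tx}$ otherwise. \textbf{Theorem (Network Dual Scaling).} The matrices $\mathbf D$ and $\mathbf D^{-1}-\mathbf\Psi^T$ are invertible, $P_q^{\rm tx}>0$ for $0\le q\le Q$, and $\mathbf A$ is entrywise nonnegative. $\mathbf A$ has a maximal eigenvalue $\lambda_{\max}$ (a real eigenvalue that is at least the modulus of every complex eigenvalue of $\mathbf A$); $\lambda_{\max}>0$, and its eigenvector is unique up to scaling and can be scaled to be strictly positive. Let $\tilde{\mathbf d}=(\tilde d_1,\dots,\tilde d_Q,1)$ be this eigenvector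 with last entry normalized to $1$. Then $\lambda_{\max}=1$ and, in the scaled dual network with scaling vector $\tilde{\mathbf d}$, $$\sum_{l=1}^L\mathrm{Tr}\big(\hat{\mathbf\Sigma}_l(\tilde{\mathbf d})\mathbf W_{Q+1}^l\big)=P_Q^{\rm tx},\qquad \mathrm{Tr}\big(\hat{\mathbf\Sigma}_q^R(\tilde{\mathbf d})\mathbf W_q\big)=\tilde d_qP_{q-1}^{\rm tx},\quad q=1,\dots,Q.$$ Consequently, whenever $P_q^{\rm tx}\le P_q$ for $q=0,\dots,Q$, these quantities are at most $P_Q$ and $\tilde d_qP_{q-1}$, $q=1,\dots,Q$, respectively. -/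

import Mathlib

open scoped Matrix ComplexOrder

noncomputable section

/-! ### Single-hop B-MAC interference networks and the covariance transformation -/

/-- Parameters of a single-hop interference network with `L` links: link `l` has a source with
`nT l` antennas and a destination with `nR l` antennas. `H l k` is the channel from the source of
link `k` to the destination of link `l`, `W l` the noise covariance at the destination of link `l`,
`What l` the linear-constraint matrix of link `l`, and `Φ` the coupling matrix. -/
structure InterferenceNetwork {L : ℕ} (nT nR : Fin L → ℕ) where
  H : ∀ l k : Fin L, Matrix (Fin (nR l)) (Fin (nT k)) ℂ
  W : ∀ l : Fin L, Matrix (Fin (nR l)) (Fin (nR l)) ℂ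
  What : ∀ l : Fin L, Matrix (Fin (nT l)) (Fin (nT l)) ℂ
  Φ : Matrix (Fin L) (Fin L) ℝ

/-- A decomposition of the input covariances into streams,
`cov l = ∑ m, p l m • t l m (t l m)ᴴ`, with unit transmit vectors and positive powers. -/
structure StreamDecomposition {L : ℕ} {nT : Fin L → ℕ}
    (cov : ∀ l : Fin L, Matrix (Fin (nT l)) (Fin (nT l)) ℂ) where
  M : Fin L → ℕ
  p : ∀ l : Fin L, Fin (M l) → ℝ
  t : ∀ l : Fin L, Fin (M l) → Fin (nT l) → ℂ
  p_pos : ∀ l m, 0 < p l m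
  t_unit : ∀ l m, ‖WithLp.toLp 2 (t l m)‖ = 1
  decomp : ∀ l, cov l = ∑ m, (p l m : ℂ) • Matrix.vecMulVec (t l m) (star (t l m))

namespace StreamDecomposition

variable {L : ℕ} {nT : Fin L → ℕ} {cov : ∀ l : Fin L, Matrix (Fin (nT l)) (Fin (nT l)) ℂ}

/-- The index set of all streams `(l, m)`. -/
abbrev Idx (S : StreamDecomposition cov) : Type := (l : Fin L) × Fin (S.M l)

end StreamDecomposition

namespace InterferenceNetwork

variable {L : ℕ} {nT nR : Fin L → ℕ} {cov : ∀ l : Fin L, Matrix (Fin (nT l)) (Fin (nT l)) ℂ}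

/-- Interference-plus-noise covariance `Ω_l` at the destination of link `l`. -/
def omega (G : InterferenceNetwork nT nR)
    (cov : ∀ l : Fin L, Matrix (Fin (nT l)) (Fin (nT l)) ℂ) (l : Fin L) :
    Matrix (Fin (nR l)) (Fin (nR l)) ℂ :=
  G.W l + ∑ k, G.Φ l k • (G.H l k * cov k * (G.H l k)ᴴ)

/-- The MMSE-SIC receive vector of stream `x = (l, m)`, with normalizing factor `α x`. -/
def recv (G : InterferenceNetwork nT nR) (S : StreamDecomposition cov) (α : S.Idx → ℂ)
    (x : S.Idx) : Fin (nR x.1) → ℂ :=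
  α x • ((∑ i ∈ Finset.Ioi x.2, (S.p x.1 i : ℂ) •
        (G.H x.1 x.1 * Matrix.vecMulVec (S.t x.1 i) (star (S.t x.1 i)) * (G.H x.1 x.1)ᴴ)
      + G.omega cov x.1)⁻¹ *ᵥ (G.H x.1 x.1 *ᵥ S.t x.1 x.2))

/-- The power gain `|r_{l,m}ᴴ H_{l,k} t_{k,n}|²` from stream `y = (k, n)` to the receive filter of
stream `x = (l, m)`. -/
def gain (G : InterferenceNetwork nT nR) (S : StreamDecomposition cov) (α : S.Idx → ℂ)
    (x y : S.Idx) : ℝ :=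
  ‖star (G.recv S α x) ⬝ᵥ (G.H x.1 y.1 *ᵥ S.t y.1 y.2)‖ ^ 2

/-- The cross-talk matrix `Ψ`: within a link, the streams `n ≤ m` do not interfere with
stream `m`; across links, interference is governed by the coupling matrix. -/
def crossTalk (G : InterferenceNetwork nT nR) (S : StreamDecomposition cov) (α : S.Idx → ℂ) :
    Matrix S.Idx S.Idx ℝ :=
  Matrix.of fun x y =>
    if y.1 = x.1 then
      if (x.2 : ℕ) < (y.2 : ℕ) then G.gain S α x y else 0
    else G.Φ x.1 y.1 * G.gain S α x y

/-- The SINR `γ_{l,m}` of stream `x = (l, m)`: received signal power over the power of the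
interference from the other streams plus noise, at the output of the receive filter. -/
def sinr (G : InterferenceNetwork nT nR) (S : StreamDecomposition cov) (α : S.Idx → ℂ)
    (x : S.Idx) : ℝ :=
  S.p x.1 x.2 * G.gain S α x x /
    ((∑ y, G.crossTalk S α x y * S.p y.1 y.2)
      + (star (G.recv S α x) ⬝ᵥ (G.W x.1 *ᵥ G.recv S α x)).re)

/-- The diagonal matrix `D` with entries `γ_{l,m} / |r_{l,m}ᴴ H_{l,l} t_{l,m}|²`. -/
def sinrMatrix (G : InterferenceNetwork nT nR) (S : StreamDecomposition cov) (α : S.Idx → ℂ) :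
    Matrix S.Idx S.Idx ℝ :=
  Matrix.diagonal fun x => G.sinr S α x / G.gain S α x x

/-- The matrix `D⁻¹ - Ψᵀ`. -/
def reverseMatrix (G : InterferenceNetwork nT nR) (S : StreamDecomposition cov)
    (α : S.Idx → ℂ) : Matrix S.Idx S.Idx ℝ :=
  (G.sinrMatrix S α)⁻¹ - (G.crossTalk S α)ᵀ

/-- The reverse transmit powers `(D⁻¹ - Ψᵀ)⁻¹ n̂`, where `n̂_{l,m} = t_{l,m}ᴴ Ŵ_l t_{l,m}`. -/
def reversePower (G : InterferenceNetwork nT nR) (S : StreamDecomposition cov)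
    (α : S.Idx → ℂ) : S.Idx → ℝ :=
  (G.reverseMatrix S α)⁻¹ *ᵥ
    fun x => (star (S.t x.1 x.2) ⬝ᵥ (G.What x.1 *ᵥ S.t x.1 x.2)).re

/-- The covariance transformation `Σ̂_l = ∑ m, q_{l,m} r_{l,m} r_{l,m}ᴴ`. -/
def covTransform (G : InterferenceNetwork nT nR) (S : StreamDecomposition cov)
    (α : S.Idx → ℂ) (l : Fin L) : Matrix (Fin (nR l)) (Fin (nR l)) ℂ :=
  ∑ m : Fin (S.M l), (G.reversePower S α ⟨l, m⟩ : ℂ) •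
    Matrix.vecMulVec (G.recv S α ⟨l, m⟩) (star (G.recv S α ⟨l, m⟩))

end InterferenceNetwork

/-! ### Multi-hop amplify-and-forward relay networks -/

/-- A B-MAC AF relay network with `L` links and `Q` relay clusters; cluster `q` (`1 ≤ q ≤ Q`) has
`n q` antennas in total, the source and destination of link `l` have `nT l` and `nR l` antennas.
Values of the cluster-indexed families outside the range of the clusters are irrelevant.
* `H0 l`: channel from the source of link `l` to cluster `1`;
* `H q`: channel from cluster `q` to cluster `q + 1`, for `1 ≤ q ≤ Q - 1`;
* `HQ l`: channel from cluster `Q` to the destination of link `l`;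
* `W q`, `WD l`: noise covariances at cluster `q` and at the destination of link `l`
  (the latter is `W_{Q+1}^l`);
* `Wh0 l`, `Wh q`: the linear-constraint matrices `Ŵ_0^l` and `Ŵ_q`, i.e. the noise covariances of
  the dual network at the dual destination of link `l` and at cluster `q`;
* `Φ`: the binary coupling matrix. -/
structure RelayNetwork (L Q : ℕ) (nT nR : Fin L → ℕ) (n : ℕ → ℕ) where
  H0 : ∀ l : Fin L, Matrix (Fin (n 1)) (Fin (nT l)) ℂ
  H : ∀ q : ℕ, Matrix (Fin (n (q + 1))) (Fin (n q)) ℂ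
  HQ : ∀ l : Fin L, Matrix (Fin (nR l)) (Fin (n Q)) ℂ
  W : ∀ q : ℕ, Matrix (Fin (n q)) (Fin (n q)) ℂ
  WD : ∀ l : Fin L, Matrix (Fin (nR l)) (Fin (nR l)) ℂ
  Wh0 : ∀ l : Fin L, Matrix (Fin (nT l)) (Fin (nT l)) ℂ
  Wh : ∀ q : ℕ, Matrix (Fin (n q)) (Fin (n q)) ℂ
  Φ : Matrix (Fin L) (Fin L) ℝ
  Φ_binary : ∀ l k, Φ l k = 0 ∨ Φ l k = 1
  Φ_diag : ∀ l, Φ l l = 0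

namespace RelayNetwork

variable {L Q : ℕ} {nT nR : Fin L → ℕ} {n : ℕ → ℕ}

/-- All noise covariances and constraint matrices are positive definite (positive semidefinite and
nonsingular). -/
structure Nonsingular (N : RelayNetwork L Q nT nR n) : Prop where
  W : ∀ q, 1 ≤ q → q ≤ Q → (N.W q).PosDef
  WD : ∀ l, (N.WD l).PosDef
  Wh0 : ∀ l, (N.Wh0 l).PosDef
  Wh : ∀ q, 1 ≤ q → q ≤ Q → (N.Wh q).PosDef

/-- `B_{q,q'} = F_{q'} H_{q'-1} F_{q'-1} ⋯ H_q F_q` for `q ≤ q'` (and `0` otherwise). -/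
def B (N : RelayNetwork L Q nT nR n) (F : ∀ q : ℕ, Matrix (Fin (n q)) (Fin (n q)) ℂ)
    (q q' : ℕ) : Matrix (Fin (n q')) (Fin (n q)) ℂ :=
  if h : q ≤ q' then
    Nat.leRec (motive := fun k _ => Matrix (Fin (n k)) (Fin (n q)) ℂ) (F q)
      (fun k _ X => F (k + 1) * N.H k * X) h
  else 0

theorem B_self (N : RelayNetwork L Q nT nR n)
    (F : ∀ q : ℕ, Matrix (Fin (n q)) (Fin (n q)) ℂ) (q : ℕ) : N.B F q q = F q := by
  simp [B]

theorem B_succ (N : RelayNetwork L Q nT nR n)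
    (F : ∀ q : ℕ, Matrix (Fin (n q)) (Fin (n q)) ℂ) {q q' : ℕ} (h : q ≤ q') :
    N.B F q (q' + 1) = F (q' + 1) * N.H q' * N.B F q q' := by
  have h' : q ≤ q' + 1 := Nat.le_succ_of_le h
  simp only [B, h, h', dite_true]
  rw [Nat.leRec_succ]

/-- The end-to-end channel `Ȟ_{l,k} = H_Q^l B_{1,Q} H_0^k`. -/
def endToEnd (N : RelayNetwork L Q nT nR n) (F : ∀ q : ℕ, Matrix (Fin (n q)) (Fin (n q)) ℂ)
    (l k : Fin L) : Matrix (Fin (nR l)) (Fin (nT k)) ℂ :=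
  N.HQ l * N.B F 1 Q * N.H0 k

/-- The covariance `Σ_q^R` of the transmit signal of cluster `q`. -/
def relayCov (N : RelayNetwork L Q nT nR n) (F : ∀ q : ℕ, Matrix (Fin (n q)) (Fin (n q)) ℂ)
    (cov : ∀ l : Fin L, Matrix (Fin (nT l)) (Fin (nT l)) ℂ) (q : ℕ) :
    Matrix (Fin (n q)) (Fin (n q)) ℂ :=
  (∑ l, N.B F 1 q * N.H0 l * cov l * (N.H0 l)ᴴ * (N.B F 1 q)ᴴ)
    + ∑ q' ∈ Finset.Icc 1 q, N.B F q' q * N.W q' * (N.B F q' q)ᴴ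

/-- The equivalent noise covariance `W'_l` at the destination of link `l`. -/
def equivNoise (N : RelayNetwork L Q nT nR n) (F : ∀ q : ℕ, Matrix (Fin (n q)) (Fin (n q)) ℂ)
    (l : Fin L) : Matrix (Fin (nR l)) (Fin (nR l)) ℂ :=
  (∑ q ∈ Finset.Icc 1 Q, N.HQ l * N.B F q Q * N.W q * (N.B F q Q)ᴴ * (N.HQ l)ᴴ) + N.WD l

/-- The equivalent constraint matrix `Ŵ'_l` of link `l`. -/
def equivConstraint (N : RelayNetwork L Q nT nR n)
    (F : ∀ q : ℕ, Matrix (Fin (n q)) (Fin (n q)) ℂ) (l : Fin L) :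
    Matrix (Fin (nT l)) (Fin (nT l)) ℂ :=
  (∑ q ∈ Finset.Icc 1 Q, (N.H0 l)ᴴ * (N.B F 1 q)ᴴ * N.Wh q * N.B F 1 q * N.H0 l) + N.Wh0 l

/-- The single-hop interference network equivalent to the relay network for fixed relay precoding
matrices, with parameters `([Ȟ_{l,k}], [W'_l], [Ŵ'_l])`. -/
def equivNetwork (N : RelayNetwork L Q nT nR n)
    (F : ∀ q : ℕ, Matrix (Fin (n q)) (Fin (n q)) ℂ) : InterferenceNetwork nT nR where
  H := N.endToEnd F
  W := N.equivNoise F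
  What := N.equivConstraint F
  Φ := N.Φ

/-- The per-hop costs `P_0^tx = ∑ l, Tr (Σ_l Ŵ_0^l)` and `P_q^tx = Tr (Σ_q^R Ŵ_q)` for `q ≥ 1`. -/
def txCost (N : RelayNetwork L Q nT nR n) (F : ∀ q : ℕ, Matrix (Fin (n q)) (Fin (n q)) ℂ)
    (cov : ∀ l : Fin L, Matrix (Fin (nT l)) (Fin (nT l)) ℂ) : ℕ → ℝ
  | 0 => ∑ l, (cov l * N.Wh0 l).trace.re
  | q + 1 => (N.relayCov F cov (q + 1) * N.Wh (q + 1)).trace.re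

/-- The per-hop linear constraint `P_q^tx ≤ P_q`, `0 ≤ q ≤ Q`. -/
def PerHopConstraint (N : RelayNetwork L Q nT nR n)
    (F : ∀ q : ℕ, Matrix (Fin (n q)) (Fin (n q)) ℂ)
    (cov : ∀ l : Fin L, Matrix (Fin (nT l)) (Fin (nT l)) ℂ) (P : Fin (Q + 1) → ℝ) : Prop :=
  ∀ q : Fin (Q + 1), N.txCost F cov q ≤ P q

/-! #### The dual network and its scaling -/

/-- `B̂_{q,q'} = F̂_{q'}ᴴ H_{q'-1} F̂_{q'-1}ᴴ ⋯ H_q F̂_qᴴ`, for dual relay precoding matrices `F̂`. -/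
def dualB (N : RelayNetwork L Q nT nR n) (Fh : ∀ q : ℕ, Matrix (Fin (n q)) (Fin (n q)) ℂ)
    (q q' : ℕ) : Matrix (Fin (n q')) (Fin (n q)) ℂ :=
  N.B (fun k => (Fh k)ᴴ) q q'

/-- The covariance `Σ̂_q^R` of the transmit signal of cluster `q` in the dual network. -/
def dualRelayCov (N : RelayNetwork L Q nT nR n)
    (Fh : ∀ q : ℕ, Matrix (Fin (n q)) (Fin (n q)) ℂ)
    (covh : ∀ l : Fin L, Matrix (Fin (nR l)) (Fin (nR l)) ℂ) (q : ℕ) :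
    Matrix (Fin (n q)) (Fin (n q)) ℂ :=
  (∑ l, (N.dualB Fh q Q)ᴴ * (N.HQ l)ᴴ * covh l * N.HQ l * N.dualB Fh q Q)
    + ∑ q' ∈ Finset.Icc q Q, (N.dualB Fh q q')ᴴ * N.Wh q' * N.dualB Fh q q'

/-- The cost `∑ l, Tr (Σ̂_l W_{Q+1}^l)` of the sources of the dual network. -/
def dualSourceCost (N : RelayNetwork L Q nT nR n)
    (covh : ∀ l : Fin L, Matrix (Fin (nR l)) (Fin (nR l)) ℂ) : ℝ :=
  ∑ l, (covh l * N.WD l).trace.re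

/-- The cost `Tr (Σ̂_q^R W_q)` of cluster `q` in the dual network. -/
def dualRelayCost (N : RelayNetwork L Q nT nR n)
    (Fh : ∀ q : ℕ, Matrix (Fin (n q)) (Fin (n q)) ℂ)
    (covh : ∀ l : Fin L, Matrix (Fin (nR l)) (Fin (nR l)) ℂ) (q : ℕ) : ℝ :=
  (N.dualRelayCov Fh covh q * N.W q).trace.re

/-- The network whose dual is the scaled dual network with scaling vector
`(d_1, …, d_{Q+1})`: the dual noise covariances `Ŵ_0^l` and `Ŵ_q` are replaced by `d_1 Ŵ_0^l` and
`d_{q+1} Ŵ_q`. Scaling vectors are indexed from `0`, so that `d q` stands for `d_{q+1}`. -/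
def scaleDual (N : RelayNetwork L Q nT nR n) (d : Fin (Q + 1) → ℝ) :
    RelayNetwork L Q nT nR n :=
  { N with
    Wh0 := fun l => d 0 • N.Wh0 l
    Wh := fun q => if h : q < Q + 1 then d ⟨q, h⟩ • N.Wh q else N.Wh q }

/-- `Σ̂(d)`: the covariance transformation with parameters `([Ȟ_{l,k}], [W'_l], [Ŵ'_l(d)])`. -/
def scaledCovTransform (N : RelayNetwork L Q nT nR n)
    (F : ∀ q : ℕ, Matrix (Fin (n q)) (Fin (n q)) ℂ)
    {cov : ∀ l : Fin L, Matrix (Fin (nT l)) (Fin (nT l)) ℂ}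
    (S : StreamDecomposition cov) (α : S.Idx → ℂ) (d : Fin (Q + 1) → ℝ) (l : Fin L) :
    Matrix (Fin (nR l)) (Fin (nR l)) ℂ :=
  ((N.scaleDual d).equivNetwork F).covTransform S α l

/-! #### The matrix of the eigensystem -/

/-- `b_{q,q'} = Tr (B_{q,q'} W_q B_{q,q'}ᴴ Ŵ_{q'})`. -/
def b (N : RelayNetwork L Q nT nR n) (F : ∀ q : ℕ, Matrix (Fin (n q)) (Fin (n q)) ℂ)
    (q q' : ℕ) : ℝ :=
  (N.B F q q' * N.W q * (N.B F q q')ᴴ * N.Wh q').trace.re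

/-- The covariance part whose quadratic form gives `n^q`, `0 ≤ q ≤ Q`:
`H_Q^l B_{q+1,Q} W_{q+1} B_{q+1,Q}ᴴ H_Q^lᴴ` for `q < Q`, and `W_{Q+1}^l` for `q = Q`. -/
def noisePart (N : RelayNetwork L Q nT nR n) (F : ∀ q : ℕ, Matrix (Fin (n q)) (Fin (n q)) ℂ)
    (q : ℕ) (l : Fin L) : Matrix (Fin (nR l)) (Fin (nR l)) ℂ :=
  if q = Q then N.WD l
  else N.HQ l * N.B F (q + 1) Q * N.W (q + 1) * (N.B F (q + 1) Q)ᴴ * (N.HQ l)ᴴ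

/-- The constraint part whose quadratic form gives `n̂^q`, `0 ≤ q ≤ Q`:
`Ŵ_0^l` for `q = 0`, and `H_0^lᴴ B_{1,q}ᴴ Ŵ_q B_{1,q} H_0^l` for `q ≥ 1`. -/
def constraintPart (N : RelayNetwork L Q nT nR n)
    (F : ∀ q : ℕ, Matrix (Fin (n q)) (Fin (n q)) ℂ) (q : ℕ) (l : Fin L) :
    Matrix (Fin (nT l)) (Fin (nT l)) ℂ :=
  if q = 0 then N.Wh0 l
  else (N.H0 l)ᴴ * (N.B F 1 q)ᴴ * N.Wh q * N.B F 1 q * N.H0 l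

/-- `n^q_{l,m} = r_{l,m}ᴴ (noisePart) r_{l,m}`. -/
def nVec (N : RelayNetwork L Q nT nR n) (F : ∀ q : ℕ, Matrix (Fin (n q)) (Fin (n q)) ℂ)
    {cov : ∀ l : Fin L, Matrix (Fin (nT l)) (Fin (nT l)) ℂ}
    (S : StreamDecomposition cov) (α : S.Idx → ℂ) (q : ℕ) (x : S.Idx) : ℝ :=
  (star ((N.equivNetwork F).recv S α x) ⬝ᵥ
    (N.noisePart F q x.1 *ᵥ (N.equivNetwork F).recv S α x)).re

/-- `n̂^q_{l,m} = t_{l,m}ᴴ (constraintPart) t_{l,m}`. -/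
def nhatVec (N : RelayNetwork L Q nT nR n) (F : ∀ q : ℕ, Matrix (Fin (n q)) (Fin (n q)) ℂ)
    {cov : ∀ l : Fin L, Matrix (Fin (nT l)) (Fin (nT l)) ℂ}
    (S : StreamDecomposition cov) (q : ℕ) (x : S.Idx) : ℝ :=
  (star (S.t x.1 x.2) ⬝ᵥ (N.constraintPart F q x.1 *ᵥ S.t x.1 x.2)).re

/-- `a_{q,q'} = n_qᵀ (D⁻¹ - Ψᵀ)⁻¹ n̂_{q'}`, `0 ≤ q, q' ≤ Q`. -/
def a (N : RelayNetwork L Q nT nR n) (F : ∀ q : ℕ, Matrix (Fin (n q)) (Fin (n q)) ℂ)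
    {cov : ∀ l : Fin L, Matrix (Fin (nT l)) (Fin (nT l)) ℂ}
    (S : StreamDecomposition cov) (α : S.Idx → ℂ) (q q' : ℕ) : ℝ :=
  N.nVec F S α q ⬝ᵥ (((N.equivNetwork F).reverseMatrix S α)⁻¹ *ᵥ N.nhatVec F S q')

/-- The matrix `A`. With rows and columns indexed from `0`, the entry `(i, j)` is the entry
`(q, q') = (i + 1, j + 1)` of the usual numbering:
`(a_{q-1,q'-1} + b_{q,q'-1}) / P_{q-1}^tx` if `q' > q`, and `a_{q-1,q'-1} / P_{q-1}^tx` otherwise. -/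
def A (N : RelayNetwork L Q nT nR n) (F : ∀ q : ℕ, Matrix (Fin (n q)) (Fin (n q)) ℂ)
    {cov : ∀ l : Fin L, Matrix (Fin (nT l)) (Fin (nT l)) ℂ}
    (S : StreamDecomposition cov) (α : S.Idx → ℂ) : Matrix (Fin (Q + 1)) (Fin (Q + 1)) ℝ :=
  Matrix.of fun i j =>
    if i < j then (N.a F S α i j + N.b F (i + 1) j) / N.txCost F cov i
    else N.a F S α i j / N.txCost F cov i

end RelayNetwork

/-- `lam` is the maximal eigenvalue of the real matrix `M`: it is an eigenvalue, and every complex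
eigenvalue of `M` has modulus at most `lam`. -/
def IsMaxEigenvalue {ι : Type*} [Fintype ι] [DecidableEq ι] (M : Matrix ι ι ℝ) (lam : ℝ) : Prop :=
  Module.End.HasEigenvalue (Matrix.toLin' M) lam ∧
    ∀ μ : ℂ, Module.End.HasEigenvalue (Matrix.toLin' (M.map Complex.ofReal)) μ → ‖μ‖ ≤ lam

end

/-! Write `P` for the vector of forward costs `txCost`. The heart of the proof is that `P` is a left
eigenvector of `A` with eigenvalue `1` (`txCost_vecMul_A`). After the denominators are cleared,
column `q'` of `A` sums to `∑ q, a q q'` plus the `b` terms of clusters `1, …, q'`. The noise parts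
`n_q` add up to the total noise vector, which equals `(D⁻¹ - Ψ) p` by the definition of the SINR, so
uplink–downlink duality gives `∑ q, a q q' = pᵀ n̂_{q'}`. This is the signal share of the cost at
hop `q'`, and the `b` terms are its noise share (`txCost_eq`).

The matrix `D⁻¹ - Ψ` has nonpositive off-diagonal entries and maps the positive powers to positive
noise powers, so it is invertible with nonnegative inverse. Since all `n_q` and `n̂_q` are positive,
every entry of `A` is positive. A positive matrix with a positive left eigenvector of eigenvalue `1`
has a direct Perron theory (`exists_perron_vector`, `norm_eigenvalue_le_one`).

Finally, the dual costs are linear in `d` with coefficients `a + b`. Hence they are the rows of `A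
d` multiplied by `P`, and `A d = d` is exactly the claimed family of identities. -/

/-! ### Inverse-positive matrices and Perron theory from a left eigenvector. -/

section NonnegativeMatrices

variable {ι : Type*} [Fintype ι]

/-- A Z-matrix that maps some positive vector to a positive vector is inverse positive. -/
theorem nonneg_of_mulVec_nonneg {K : Matrix ι ι ℝ} (hK : ∀ i j, i ≠ j → K i j ≤ 0)
    {p : ι → ℝ} (hp : ∀ i, 0 < p i) (hKp : ∀ i, 0 < (K *ᵥ p) i)
    {v : ι → ℝ} (hv : ∀ i, 0 ≤ (K *ᵥ v) i) (i : ι) : 0 ≤ v i := by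
  -- At the minimal ratio `m`, the vector `v - m p` is nonnegative and vanishes at `i₀`, so row `i₀`
  -- of `K (v - m p)` involves only off-diagonal entries and is nonpositive. This is impossible when
  -- `m < 0`.
  obtain ⟨i₀, -, hmin⟩ := Finset.exists_min_image Finset.univ (fun i => v i / p i) ⟨i, by simp⟩
  set m := v i₀ / p i₀ with hm
  have hle : ∀ j, m * p j ≤ v j := fun j => (le_div_iff₀ (hp j)).1 (hmin j (Finset.mem_univ j))
  have heq : m * p i₀ = v i₀ := div_mul_cancel₀ _ (hp i₀).ne'
  suffices hm0 : 0 ≤ m from (mul_nonneg hm0 (hp i).le).trans (hle i)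
  by_contra! hneg
  have h1 : (K *ᵥ v) i₀ - m * (K *ᵥ p) i₀ ≤ 0 := by
    rw [Matrix.mulVec, Matrix.mulVec, dotProduct, dotProduct, Finset.mul_sum,
      ← Finset.sum_sub_distrib]
    refine Finset.sum_nonpos fun j _ => ?_
    rcases eq_or_ne i₀ j with rfl | hj
    · rw [← heq]; exact le_of_eq (by ring)
    · nlinarith [mul_nonpos_of_nonpos_of_nonneg (hK i₀ j hj) (sub_nonneg.2 (hle j))]
  nlinarith [hv i₀, mul_neg_of_neg_of_pos hneg (hKp i₀)]

/-- A kernel vector and its negative are both nonnegative by `nonneg_of_mulVec_nonneg`. -/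
theorem isUnit_of_mulVec_pos [DecidableEq ι] {K : Matrix ι ι ℝ}
    (hK : ∀ i j, i ≠ j → K i j ≤ 0) {p : ι → ℝ} (hp : ∀ i, 0 < p i)
    (hKp : ∀ i, 0 < (K *ᵥ p) i) : IsUnit K := by
  rw [Matrix.isUnit_iff_isUnit_det, isUnit_iff_ne_zero]
  intro h0
  obtain ⟨v, hv, hKv⟩ := Matrix.exists_mulVec_eq_zero_iff.2 h0
  refine hv (funext fun i => le_antisymm ?_ ?_)
  · have := nonneg_of_mulVec_nonneg hK hp hKp (v := -v) (by simp [Matrix.mulVec_neg, hKv]) i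
    simpa using this
  · exact nonneg_of_mulVec_nonneg hK hp hKp (by simp [hKv]) i

/-- Column `j` of the inverse solves `K v = e_j`, whose right-hand side is nonnegative. -/
theorem inv_nonneg_of_mulVec_pos [DecidableEq ι] {K : Matrix ι ι ℝ}
    (hK : ∀ i j, i ≠ j → K i j ≤ 0) {p : ι → ℝ} (hp : ∀ i, 0 < p i)
    (hKp : ∀ i, 0 < (K *ᵥ p) i) (i j : ι) : 0 ≤ K⁻¹ i j := by
  have hdet := (Matrix.isUnit_iff_isUnit_det K).1 (isUnit_of_mulVec_pos hK hp hKp)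
  have := nonneg_of_mulVec_nonneg hK hp hKp (v := K⁻¹ *ᵥ Pi.single j 1) (fun k => by
    rw [Matrix.mulVec_mulVec, Matrix.mul_nonsing_inv K hdet, Matrix.one_mulVec]
    by_cases h : k = j
    · subst h; simp
    · simp [h]) i
  simpa using this

/-- The pairing of two positive vectors through a nonnegative nonsingular matrix is positive. -/
theorem dotProduct_mulVec_pos_of_nonneg [DecidableEq ι] [Nonempty ι] {M : Matrix ι ι ℝ}
    (hM : IsUnit M) (h0 : ∀ i j, 0 ≤ M i j) {u v : ι → ℝ} (hu : ∀ i, 0 < u i)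
    (hv : ∀ i, 0 < v i) : 0 < u ⬝ᵥ (M *ᵥ v) := by
  obtain ⟨i, j, hij⟩ : ∃ i j, M i j ≠ 0 := by
    by_contra! h
    exact hM.ne_zero (Matrix.ext h)
  have hMv : ∀ k, 0 ≤ (M *ᵥ v) k := fun k =>
    Finset.sum_nonneg fun l _ => mul_nonneg (h0 k l) (hv l).le
  refine Finset.sum_pos' (fun k _ => mul_nonneg (hu k).le (hMv k)) ⟨i, Finset.mem_univ i, ?_⟩
  exact mul_pos (hu i) (Finset.sum_pos' (fun l _ => mul_nonneg (h0 i l) (hv l).le)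
    ⟨j, Finset.mem_univ j, mul_pos ((h0 i j).lt_of_ne' hij) (hv j)⟩)

/-- A nonnegative matrix with a positive left eigenvector of eigenvalue `1` fixes every
nonnegative vector that it does not decrease. -/
theorem mulVec_eq_self_of_le {A : Matrix ι ι ℝ} {P : ι → ℝ} (hP : ∀ i, 0 < P i)
    (hPA : P ᵥ* A = P) {u : ι → ℝ} (hu : ∀ i, u i ≤ (A *ᵥ u) i) : A *ᵥ u = u := by
  -- The `P`-weighted sums of `u` and `A u` agree, so no entrywise inequality can be strict.
  have h : P ⬝ᵥ u = P ⬝ᵥ (A *ᵥ u) := by rw [Matrix.dotProduct_mulVec, hPA]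
  funext i
  have := (Finset.sum_eq_sum_iff_of_le
    (fun i _ => mul_le_mul_of_nonneg_left (hu i) (hP i).le)).1 h i (Finset.mem_univ i)
  exact (mul_left_cancel₀ (hP i).ne' this).symm

theorem pos_of_mulVec_eq_self {A : Matrix ι ι ℝ} (hA : ∀ i j, 0 < A i j) {u : ι → ℝ}
    (hu : ∀ i, 0 ≤ u i) (hu0 : u ≠ 0) (h : A *ᵥ u = u) (i : ι) : 0 < u i := by
  obtain ⟨j, hj⟩ := Function.ne_iff.1 hu0
  rw [← h]
  exact Finset.sum_pos' (fun k _ => mul_nonneg (hA i k).le (hu k))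
    ⟨j, Finset.mem_univ j, mul_pos (hA i j) ((hu j).lt_of_ne' hj)⟩

/-- The triangle inequality gives `|v| ≤ A |v|`, and the left eigenvector upgrades this to equality.
-/
theorem abs_mulVec_eq_self {A : Matrix ι ι ℝ} (hA : ∀ i j, 0 ≤ A i j) {P : ι → ℝ}
    (hP : ∀ i, 0 < P i) (hPA : P ᵥ* A = P) {v : ι → ℝ} (hv : A *ᵥ v = v) :
    (A *ᵥ fun i => |v i|) = fun i => |v i| := by
  refine mulVec_eq_self_of_le hP hPA fun i => ?_
  calc |v i| = |(A *ᵥ v) i| := by rw [hv]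
    _ ≤ ∑ j, |A i j * v j| := Finset.abs_sum_le_sum_abs _ _
    _ = _ := Finset.sum_congr rfl fun j _ => by rw [abs_mul, abs_of_nonneg (hA i j)]

/-- Every complex eigenvalue of a nonnegative matrix with a positive left eigenvector of
eigenvalue `1` lies in the closed unit disc. -/
theorem norm_eigenvalue_le_one [DecidableEq ι] {A : Matrix ι ι ℝ} (hA : ∀ i j, 0 ≤ A i j)
    {P : ι → ℝ} (hP : ∀ i, 0 < P i) (hPA : P ᵥ* A = P) {μ : ℂ}
    (hμ : Module.End.HasEigenvalue (Matrix.toLin' (A.map Complex.ofReal)) μ) : ‖μ‖ ≤ 1 := by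
  obtain ⟨v, hv⟩ := hμ.exists_hasEigenvector
  have hv' := hv.apply_eq_smul
  rw [Matrix.toLin'_apply] at hv'
  have hle : ∀ i, ‖μ‖ * ‖v i‖ ≤ (A *ᵥ fun j => ‖v j‖) i := fun i => by
    rw [← norm_mul, ← smul_eq_mul, ← Pi.smul_apply, ← hv']
    refine (norm_sum_le _ _).trans_eq (Finset.sum_congr rfl fun j _ => ?_)
    simp [abs_of_nonneg (hA i j)]
  -- Pairing `|μ| |v| ≤ A |v|` with `P` absorbs `A`, leaving a comparison of scalars.
  have hsum : ‖μ‖ * (P ⬝ᵥ fun j => ‖v j‖) ≤ P ⬝ᵥ fun j => ‖v j‖ := by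
    conv_rhs => rw [← hPA, ← Matrix.dotProduct_mulVec]
    rw [dotProduct, Finset.mul_sum]
    refine Finset.sum_le_sum fun i _ => ?_
    have := mul_le_mul_of_nonneg_left (hle i) (hP i).le
    linarith
  obtain ⟨j, hj⟩ := Function.ne_iff.1 hv.2
  have hpos : 0 < P ⬝ᵥ fun j => ‖v j‖ :=
    Finset.sum_pos' (fun k _ => mul_nonneg (hP k).le (norm_nonneg _))
      ⟨j, Finset.mem_univ j, mul_pos (hP j) (norm_pos_iff.2 hj)⟩
  exact le_of_mul_le_mul_right (by rwa [one_mul]) hpos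

/-- Perron's theorem for a positive matrix with a positive left eigenvector of eigenvalue `1`. -/
theorem exists_perron_vector [DecidableEq ι] {A : Matrix ι ι ℝ} (hA : ∀ i j, 0 < A i j)
    {P : ι → ℝ} (hP : ∀ i, 0 < P i) (hPA : P ᵥ* A = P) (k : ι) :
    ∃ d : ι → ℝ, A *ᵥ d = d ∧ (∀ i, 0 < d i) ∧ d k = 1 ∧
      ∀ v, A *ᵥ v = v → ∃ c : ℝ, v = c • d := by
  have hA0 : ∀ i j, 0 ≤ A i j := fun i j => (hA i j).le
  have habs : ∀ v : ι → ℝ, v ≠ 0 → A *ᵥ v = v → ∀ i, 0 < |v i| := fun v hv0 hv =>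
    pos_of_mulVec_eq_self hA (fun i => abs_nonneg _)
      (fun h => hv0 (funext fun i => abs_eq_zero.1 (congrFun h i)))
      (abs_mulVec_eq_self hA0 hP hPA hv)
  -- The left kernel vector `P` makes `1 - A` singular, so a right fixed vector exists as well.
  have hdet : (1 - A).det = 0 := by
    refine Matrix.exists_vecMul_eq_zero_iff.1 ⟨P, fun h => (hP k).ne' (congrFun h k), ?_⟩
    rw [Matrix.vecMul_sub, Matrix.vecMul_one, hPA, sub_self]
  obtain ⟨v, hv0, hv⟩ := Matrix.exists_mulVec_eq_zero_iff.2 hdet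
  rw [Matrix.sub_mulVec, Matrix.one_mulVec, sub_eq_zero] at hv
  have hvpos := habs v hv0 hv.symm
  have hdA : (A *ᵥ (|v k|⁻¹ • fun i => |v i|)) = |v k|⁻¹ • fun i => |v i| := by
    rw [Matrix.mulVec_smul, abs_mulVec_eq_self hA0 hP hPA hv.symm]
  have hdk : (|v k|⁻¹ • fun i => |v i|) k = 1 := inv_mul_cancel₀ (hvpos k).ne'
  refine ⟨|v k|⁻¹ • fun i => |v i|, hdA, fun i => mul_pos (inv_pos.2 (hvpos k)) (hvpos i), hdk,
    fun w hw => ⟨w k, ?_⟩⟩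
  by_contra hne
  -- A nonzero fixed vector has no zero entry, but this difference is fixed and vanishes at `k`.
  have := habs (w - w k • (|v k|⁻¹ • fun i => |v i|)) (sub_ne_zero.2 hne)
    (by rw [Matrix.mulVec_sub, hw, Matrix.mulVec_smul, hdA]) k
  rw [Pi.sub_apply, Pi.smul_apply, hdk] at this
  simp at this

theorem isMaxEigenvalue_one [DecidableEq ι] {A : Matrix ι ι ℝ} (hA : ∀ i j, 0 ≤ A i j)
    {P : ι → ℝ} (hP : ∀ i, 0 < P i) (hPA : P ᵥ* A = P) {d : ι → ℝ} (hd0 : d ≠ 0)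
    (hd : A *ᵥ d = d) : IsMaxEigenvalue A 1 :=
  ⟨Module.End.hasEigenvalue_of_hasEigenvector (x := d)
    ⟨Module.End.mem_eigenspace_iff.2 (by simpa using hd), hd0⟩,
    fun _ hμ => norm_eigenvalue_le_one hA hP hPA hμ⟩

end NonnegativeMatrices

/-! ### Hermitian forms and traces. -/

section QuadraticForms

variable {m n : Type*} [Fintype m] [Fintype n]

/-- The real part of the Hermitian form `vᴴ M v`. -/
noncomputable def quadForm (M : Matrix n n ℂ) (v : n → ℂ) : ℝ := (star v ⬝ᵥ (M *ᵥ v)).re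

theorem quadForm_add (M N : Matrix n n ℂ) (v : n → ℂ) :
    quadForm (M + N) v = quadForm M v + quadForm N v := by
  simp [quadForm, Matrix.add_mulVec]

theorem quadForm_sum {κ : Type*} (s : Finset κ) (M : κ → Matrix n n ℂ) (v : n → ℂ) :
    quadForm (∑ i ∈ s, M i) v = ∑ i ∈ s, quadForm (M i) v := by
  classical
  induction s using Finset.induction_on with
  | empty => simp [quadForm]
  | insert i s hi ih => rw [Finset.sum_insert hi, Finset.sum_insert hi, quadForm_add, ih]

theorem quadForm_smul (c : ℝ) (M : Matrix n n ℂ) (v : n → ℂ) :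
    quadForm (c • M) v = c * quadForm M v := by
  simp [quadForm, Matrix.smul_mulVec]

theorem quadForm_pos {M : Matrix n n ℂ} (hM : M.PosDef) {v : n → ℂ} (hv : v ≠ 0) :
    0 < quadForm M v :=
  (Complex.pos_iff.1 (hM.dotProduct_mulVec_pos hv)).1

theorem quadForm_conj (M : Matrix n n ℂ) (X : Matrix n m ℂ) (v : m → ℂ) :
    quadForm (Xᴴ * M * X) v = quadForm M (X *ᵥ v) := by
  rw [quadForm, quadForm, Matrix.star_mulVec, ← Matrix.dotProduct_mulVec, Matrix.mulVec_mulVec,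
    Matrix.mulVec_mulVec, Matrix.mul_assoc]

theorem quadForm_conjTranspose (M : Matrix n n ℂ) (X : Matrix m n ℂ) (v : m → ℂ) :
    quadForm (X * M * Xᴴ) v = quadForm M (Xᴴ *ᵥ v) := by
  simpa using quadForm_conj M Xᴴ v

theorem trace_vecMulVec_star_mul (M : Matrix n n ℂ) (v : n → ℂ) :
    (Matrix.vecMulVec v (star v) * M).trace.re = quadForm M v := by
  rw [Matrix.trace_mul_comm, Matrix.mul_vecMulVec, Matrix.trace_vecMulVec, dotProduct_comm,
    quadForm]

theorem trace_sum_smul_vecMulVec_mul {κ : Type*} (s : Finset κ) (c : κ → ℝ) (v : κ → n → ℂ)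
    (M : Matrix n n ℂ) :
    ((∑ i ∈ s, (c i : ℂ) • Matrix.vecMulVec (v i) (star (v i))) * M).trace.re
      = ∑ i ∈ s, c i * quadForm M (v i) := by
  simp only [Finset.sum_mul, Matrix.trace_sum, Complex.re_sum, Matrix.smul_mul,
    Matrix.trace_smul, smul_eq_mul, Complex.re_ofReal_mul, trace_vecMulVec_star_mul]

-- With `X = Yᴴ Y`, cyclicity turns the trace into that of the positive semidefinite `Y M Yᴴ`.
open scoped MatrixOrder in
theorem trace_mul_nonneg [DecidableEq n] {X M : Matrix n n ℂ} (hX : X.PosSemidef)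
    (hM : M.PosSemidef) : 0 ≤ (X * M).trace.re := by
  obtain ⟨Y, rfl⟩ := CStarAlgebra.nonneg_iff_eq_star_mul_self.mp hX.nonneg
  rw [Matrix.mul_assoc, Matrix.trace_mul_comm]
  exact (Complex.nonneg_iff.1 (hM.mul_mul_conjTranspose_same Y).trace_nonneg).1

end QuadraticForms

/-! ### Stream decompositions. -/

namespace StreamDecomposition

variable {L : ℕ} {nT : Fin L → ℕ} {cov : ∀ l : Fin L, Matrix (Fin (nT l)) (Fin (nT l)) ℂ}

theorem t_ne_zero (S : StreamDecomposition cov) (x : S.Idx) : S.t x.1 x.2 ≠ 0 := by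
  intro h
  have := S.t_unit x.1 x.2
  rw [h] at this
  simp at this

theorem posSemidef_smul_vecMulVec (S : StreamDecomposition cov) (l : Fin L) (m : Fin (S.M l)) :
    ((S.p l m : ℂ) • Matrix.vecMulVec (S.t l m) (star (S.t l m))).PosSemidef :=
  (Matrix.posSemidef_vecMulVec_self_star _).smul (by exact_mod_cast (S.p_pos l m).le)

theorem cov_posSemidef (S : StreamDecomposition cov) (l : Fin L) : (cov l).PosSemidef := by
  rw [S.decomp l]
  exact Matrix.posSemidef_sum _ fun m _ => S.posSemidef_smul_vecMulVec l m

/-- With no streams every `a q q'` would be an empty sum and `A` could not be positive; this is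
where a nonzero input covariance is needed. -/
theorem nonempty_idx (S : StreamDecomposition cov) (hcov : ∃ l, cov l ≠ 0) : Nonempty S.Idx := by
  obtain ⟨l, hl⟩ := hcov
  by_contra h
  refine hl ?_
  rw [S.decomp l]
  exact Finset.sum_eq_zero fun m _ => (h ⟨⟨l, m⟩⟩).elim

/-- `∑ l, Tr (Σ_l M_l) = ∑ x, p_x t_xᴴ M t_x`. -/
theorem sum_trace_cov_mul (S : StreamDecomposition cov)
    (M : ∀ l : Fin L, Matrix (Fin (nT l)) (Fin (nT l)) ℂ) :
    ∑ l, (cov l * M l).trace.re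
      = ∑ x : S.Idx, S.p x.1 x.2 * quadForm (M x.1) (S.t x.1 x.2) := by
  rw [Fintype.sum_sigma]
  refine Finset.sum_congr rfl fun l _ => ?_
  conv_lhs => rw [S.decomp l]
  exact trace_sum_smul_vecMulVec_mul _ _ _ _

end StreamDecomposition

/-! ### SINR matrices and uplink–downlink duality. -/

namespace InterferenceNetwork

variable {L : ℕ} {nT nR : Fin L → ℕ} {cov : ∀ l : Fin L, Matrix (Fin (nT l)) (Fin (nT l)) ℂ}
  {G : InterferenceNetwork nT nR} {S : StreamDecomposition cov} {α : S.Idx → ℂ}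

theorem omega_posDef (S : StreamDecomposition cov) (hW : ∀ l, (G.W l).PosDef)
    (hΦ : ∀ l k, 0 ≤ G.Φ l k) (l : Fin L) : (G.omega cov l).PosDef :=
  (hW l).add_posSemidef <| Matrix.posSemidef_sum _ fun k _ =>
    ((S.cov_posSemidef k).mul_mul_conjTranspose_same (G.H l k)).smul (hΦ l k)

theorem coeff_ne_zero {x : S.Idx} (hr : G.recv S α x ≠ 0) : α x ≠ 0 := by
  rintro h
  exact hr (by simp [recv, h])

theorem channel_mulVec_ne_zero {x : S.Idx} (hr : G.recv S α x ≠ 0) :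
    G.H x.1 x.1 *ᵥ S.t x.1 x.2 ≠ 0 := by
  rintro h
  exact hr (by simp [recv, h])

/-- The MMSE form of the receive vector makes this product `star α` times the form of a positive
definite inverse at the nonzero vector `H t`. -/
theorem recv_dotProduct_ne_zero (hW : ∀ l, (G.W l).PosDef) (hΦ : ∀ l k, 0 ≤ G.Φ l k)
    {x : S.Idx} (hr : G.recv S α x ≠ 0) :
    star (G.recv S α x) ⬝ᵥ (G.H x.1 x.1 *ᵥ S.t x.1 x.2) ≠ 0 := by
  have hpd : (∑ i ∈ Finset.Ioi x.2, (S.p x.1 i : ℂ) •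
        (G.H x.1 x.1 * Matrix.vecMulVec (S.t x.1 i) (star (S.t x.1 i)) * (G.H x.1 x.1)ᴴ)
      + G.omega cov x.1).PosDef := by
    refine Matrix.PosDef.posSemidef_add (Matrix.posSemidef_sum _ fun i _ => ?_)
      (omega_posDef S hW hΦ x.1)
    exact ((Matrix.posSemidef_vecMulVec_self_star _).mul_mul_conjTranspose_same _).smul
      (by exact_mod_cast (S.p_pos x.1 i).le)
  have hpos := hpd.inv.dotProduct_mulVec_pos (channel_mulVec_ne_zero hr)
  rw [recv, star_smul, smul_dotProduct, Matrix.star_mulVec, ← Matrix.dotProduct_mulVec,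
    hpd.inv.isHermitian.eq, smul_eq_mul]
  exact mul_ne_zero (star_ne_zero.2 (coeff_ne_zero hr)) hpos.ne'

theorem gain_self_pos (hW : ∀ l, (G.W l).PosDef) (hΦ : ∀ l k, 0 ≤ G.Φ l k)
    {x : S.Idx} (hr : G.recv S α x ≠ 0) : 0 < G.gain S α x x :=
  pow_pos (norm_pos_iff.2 (recv_dotProduct_ne_zero hW hΦ hr)) 2

theorem crossTalk_nonneg (hΦ : ∀ l k, 0 ≤ G.Φ l k) (x y : S.Idx) : 0 ≤ G.crossTalk S α x y := by
  have : 0 ≤ G.gain S α x y := sq_nonneg _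
  simp only [crossTalk, Matrix.of_apply]
  split_ifs
  exacts [this, le_rfl, mul_nonneg (hΦ _ _) this]

/-- The interference-plus-noise power of a stream at the output of its receive filter. -/
noncomputable def interference (G : InterferenceNetwork nT nR) (S : StreamDecomposition cov) (α : S.Idx → ℂ)
    (x : S.Idx) : ℝ :=
  (∑ y, G.crossTalk S α x y * S.p y.1 y.2) + quadForm (G.W x.1) (G.recv S α x)

theorem interference_pos (hW : ∀ l, (G.W l).PosDef) (hΦ : ∀ l k, 0 ≤ G.Φ l k)
    {x : S.Idx} (hr : G.recv S α x ≠ 0) : 0 < G.interference S α x :=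
  add_pos_of_nonneg_of_pos
    (Finset.sum_nonneg fun y _ => mul_nonneg (crossTalk_nonneg hΦ x y) (S.p_pos y.1 y.2).le)
    (quadForm_pos (hW x.1) hr)

/-- The signal gain in the SINR cancels against the one in the definition of `D`, leaving power over
interference. -/
theorem sinrMatrix_eq (hW : ∀ l, (G.W l).PosDef) (hΦ : ∀ l k, 0 ≤ G.Φ l k)
    (hr : ∀ x, G.recv S α x ≠ 0) :
    G.sinrMatrix S α = Matrix.diagonal fun x => S.p x.1 x.2 / G.interference S α x := by
  rw [sinrMatrix]
  congr 1
  funext x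
  have h := (gain_self_pos hW hΦ (hr x)).ne'
  change S.p x.1 x.2 * G.gain S α x x / G.interference S α x / G.gain S α x x = _
  rw [div_right_comm, mul_div_cancel_right₀ _ h]

theorem sinrMatrix_mul (hW : ∀ l, (G.W l).PosDef) (hΦ : ∀ l k, 0 ≤ G.Φ l k)
    (hr : ∀ x, G.recv S α x ≠ 0) :
    G.sinrMatrix S α * Matrix.diagonal (fun x => G.interference S α x / S.p x.1 x.2) = 1 := by
  rw [sinrMatrix_eq hW hΦ hr, Matrix.diagonal_mul_diagonal, ← Matrix.diagonal_one]
  congr 1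
  funext x
  rw [div_mul_div_comm, mul_comm, div_self]
  exact mul_ne_zero (interference_pos hW hΦ (hr x)).ne' (S.p_pos x.1 x.2).ne'

theorem isUnit_sinrMatrix (hW : ∀ l, (G.W l).PosDef) (hΦ : ∀ l k, 0 ≤ G.Φ l k)
    (hr : ∀ x, G.recv S α x ≠ 0) : IsUnit (G.sinrMatrix S α) :=
  IsUnit.of_mul_eq_one _ (sinrMatrix_mul hW hΦ hr)

theorem transpose_reverseMatrix (hW : ∀ l, (G.W l).PosDef) (hΦ : ∀ l k, 0 ≤ G.Φ l k)
    (hr : ∀ x, G.recv S α x ≠ 0) :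
    (G.reverseMatrix S α)ᵀ
      = Matrix.diagonal (fun x => G.interference S α x / S.p x.1 x.2) - G.crossTalk S α := by
  rw [reverseMatrix, Matrix.inv_eq_right_inv (sinrMatrix_mul hW hΦ hr), Matrix.transpose_sub,
    Matrix.diagonal_transpose, Matrix.transpose_transpose]

/-- The diagonal part returns the full interference-plus-noise power and `Ψ p` removes the
interference. Both the inverse positivity and the duality rest on this identity. -/
theorem transpose_reverseMatrix_mulVec (hW : ∀ l, (G.W l).PosDef) (hΦ : ∀ l k, 0 ≤ G.Φ l k)
    (hr : ∀ x, G.recv S α x ≠ 0) :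
    ((G.reverseMatrix S α)ᵀ *ᵥ fun x => S.p x.1 x.2)
      = fun x => quadForm (G.W x.1) (G.recv S α x) := by
  rw [transpose_reverseMatrix hW hΦ hr, Matrix.sub_mulVec]
  funext x
  rw [Pi.sub_apply, Matrix.mulVec_diagonal, div_mul_cancel₀ _ (S.p_pos x.1 x.2).ne']
  exact add_sub_cancel_left _ _

theorem transpose_reverseMatrix_offDiag (hW : ∀ l, (G.W l).PosDef) (hΦ : ∀ l k, 0 ≤ G.Φ l k)
    (hr : ∀ x, G.recv S α x ≠ 0) (x y : S.Idx) (hxy : x ≠ y) :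
    (G.reverseMatrix S α)ᵀ x y ≤ 0 := by
  rw [transpose_reverseMatrix hW hΦ hr, Matrix.sub_apply, Matrix.diagonal_apply_ne _ hxy, zero_sub]
  exact neg_nonpos.2 (crossTalk_nonneg hΦ x y)

theorem transpose_reverseMatrix_mulVec_pos (hW : ∀ l, (G.W l).PosDef) (hΦ : ∀ l k, 0 ≤ G.Φ l k)
    (hr : ∀ x, G.recv S α x ≠ 0) (x : S.Idx) :
    0 < ((G.reverseMatrix S α)ᵀ *ᵥ fun x => S.p x.1 x.2) x := by
  rw [transpose_reverseMatrix_mulVec hW hΦ hr]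
  exact quadForm_pos (hW x.1) (hr x)

theorem isUnit_reverseMatrix (hW : ∀ l, (G.W l).PosDef) (hΦ : ∀ l k, 0 ≤ G.Φ l k)
    (hr : ∀ x, G.recv S α x ≠ 0) : IsUnit (G.reverseMatrix S α) :=
  (Matrix.isUnit_transpose _).1 <| isUnit_of_mulVec_pos (transpose_reverseMatrix_offDiag hW hΦ hr)
    (fun x => S.p_pos x.1 x.2) (transpose_reverseMatrix_mulVec_pos hW hΦ hr)

theorem inv_reverseMatrix_nonneg (hW : ∀ l, (G.W l).PosDef) (hΦ : ∀ l k, 0 ≤ G.Φ l k)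
    (hr : ∀ x, G.recv S α x ≠ 0) (x y : S.Idx) : 0 ≤ (G.reverseMatrix S α)⁻¹ x y := by
  have := inv_nonneg_of_mulVec_pos (transpose_reverseMatrix_offDiag hW hΦ hr)
    (fun x => S.p_pos x.1 x.2) (transpose_reverseMatrix_mulVec_pos hW hΦ hr) y x
  rwa [← Matrix.transpose_nonsing_inv] at this

/-- Uplink–downlink duality: pairing the noise powers with `(D⁻¹ - Ψᵀ)⁻¹ u` is pairing the stream
powers with `u`. -/
theorem noise_dotProduct_inv_reverseMatrix (hW : ∀ l, (G.W l).PosDef)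
    (hΦ : ∀ l k, 0 ≤ G.Φ l k) (hr : ∀ x, G.recv S α x ≠ 0) (u : S.Idx → ℝ) :
    (fun x => quadForm (G.W x.1) (G.recv S α x)) ⬝ᵥ ((G.reverseMatrix S α)⁻¹ *ᵥ u)
      = (fun x => S.p x.1 x.2) ⬝ᵥ u := by
  rw [← transpose_reverseMatrix_mulVec hW hΦ hr, Matrix.mulVec_transpose,
    ← Matrix.dotProduct_mulVec, Matrix.mulVec_mulVec, Matrix.mul_nonsing_inv, Matrix.one_mulVec]
  exact (Matrix.isUnit_iff_isUnit_det _).1 (isUnit_reverseMatrix hW hΦ hr)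

theorem trace_covTransform_mul (l : Fin L) (M : Matrix (Fin (nR l)) (Fin (nR l)) ℂ) :
    (G.covTransform S α l * M).trace.re
      = ∑ m : Fin (S.M l), G.reversePower S α ⟨l, m⟩ * quadForm M (G.recv S α ⟨l, m⟩) := by
  rw [covTransform, trace_sum_smul_vecMulVec_mul Finset.univ
    (fun m : Fin (S.M l) => G.reversePower S α ⟨l, m⟩)]

theorem sum_trace_covTransform_mul (M : ∀ l, Matrix (Fin (nR l)) (Fin (nR l)) ℂ) :
    ∑ l, (G.covTransform S α l * M l).trace.re
      = ∑ x : S.Idx, G.reversePower S α x * quadForm (M x.1) (G.recv S α x) := by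
  rw [Fintype.sum_sigma]
  exact Finset.sum_congr rfl fun l _ => trace_covTransform_mul l (M l)

end InterferenceNetwork

/-! ### Independence of the constraint matrices. -/

namespace InterferenceNetwork

variable {L : ℕ} {nT nR : Fin L → ℕ} {cov : ∀ l : Fin L, Matrix (Fin (nT l)) (Fin (nT l)) ℂ}
  (G : InterferenceNetwork nT nR) (S : StreamDecomposition cov) (α : S.Idx → ℂ)
  (What : ∀ l : Fin L, Matrix (Fin (nT l)) (Fin (nT l)) ℂ)

/-- Receive vectors, `Ψ` and `D` are forward-network data, so scaling the dual noise changes only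
the vector `n̂`. -/
theorem recv_setConstraint : { G with What := What }.recv S α = G.recv S α := by
  funext x
  simp only [recv, omega]

theorem crossTalk_setConstraint : { G with What := What }.crossTalk S α = G.crossTalk S α := by
  ext x y
  simp only [crossTalk, gain, recv_setConstraint]

theorem reverseMatrix_setConstraint :
    { G with What := What }.reverseMatrix S α = G.reverseMatrix S α := by
  simp only [reverseMatrix, sinrMatrix, sinr, gain, crossTalk_setConstraint, recv_setConstraint]

end InterferenceNetwork

/-! ### Positivity and the left eigenvector for the relay network. -/

namespace RelayNetwork

variable {L Q : ℕ} {nT nR : Fin L → ℕ} {n : ℕ → ℕ} {N : RelayNetwork L Q nT nR n}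
  {F : ∀ q : ℕ, Matrix (Fin (n q)) (Fin (n q)) ℂ}
  {cov : ∀ l : Fin L, Matrix (Fin (nT l)) (Fin (nT l)) ℂ}
  {S : StreamDecomposition cov} {α : S.Idx → ℂ}

/-- Cutting the relay chain at a hop lets the end-to-end channel be factored through any cluster. -/
theorem B_eq_mul (N : RelayNetwork L Q nT nR n) (F : ∀ q : ℕ, Matrix (Fin (n q)) (Fin (n q)) ℂ)
    {q k q' : ℕ} (hqk : q ≤ k) (hk : k + 1 ≤ q') :
    N.B F q q' = N.B F (k + 1) q' * (N.H k * N.B F q k) := by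
  induction q', hk using Nat.le_induction with
  | base => rw [B_self, B_succ N F hqk, Matrix.mul_assoc]
  | succ q' hk ih =>
    rw [B_succ N F (by lia : q ≤ q'), B_succ N F hk, ih, Matrix.mul_assoc _ (N.B F (k + 1) q')]

theorem coupling_nonneg (N : RelayNetwork L Q nT nR n)
    (F : ∀ q : ℕ, Matrix (Fin (n q)) (Fin (n q)) ℂ) (l k : Fin L) :
    0 ≤ (N.equivNetwork F).Φ l k := by
  change 0 ≤ N.Φ l k
  rcases N.Φ_binary l k with h | h <;> simp [h]

theorem noisePart_of_lt (N : RelayNetwork L Q nT nR n)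
    (F : ∀ q : ℕ, Matrix (Fin (n q)) (Fin (n q)) ℂ) {q : ℕ} (hq : q < Q) (l : Fin L) :
    N.noisePart F q l
      = (N.HQ l * N.B F (q + 1) Q) * N.W (q + 1) * (N.HQ l * N.B F (q + 1) Q)ᴴ := by
  rw [noisePart, if_neg hq.ne, Matrix.conjTranspose_mul]
  simp only [Matrix.mul_assoc]

theorem noisePart_self (N : RelayNetwork L Q nT nR n)
    (F : ∀ q : ℕ, Matrix (Fin (n q)) (Fin (n q)) ℂ) (l : Fin L) : N.noisePart F Q l = N.WD l :=
  if_pos rfl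

theorem constraintPart_zero (N : RelayNetwork L Q nT nR n)
    (F : ∀ q : ℕ, Matrix (Fin (n q)) (Fin (n q)) ℂ) (l : Fin L) :
    N.constraintPart F 0 l = N.Wh0 l :=
  if_pos rfl

theorem constraintPart_of_pos (N : RelayNetwork L Q nT nR n)
    (F : ∀ q : ℕ, Matrix (Fin (n q)) (Fin (n q)) ℂ) {q : ℕ} (hq : 1 ≤ q) (l : Fin L) :
    N.constraintPart F q l = (N.B F 1 q * N.H0 l)ᴴ * N.Wh q * (N.B F 1 q * N.H0 l) := by
  rw [constraintPart, if_neg (by lia), Matrix.conjTranspose_mul]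
  simp only [Matrix.mul_assoc]

theorem sum_Icc_one_eq_sum_range {β : Type*} [AddCommMonoid β] (f : ℕ → β) (m : ℕ) :
    ∑ q ∈ Finset.Icc 1 m, f q = ∑ q ∈ Finset.range m, f (q + 1) := by
  rw [Finset.range_eq_Ico, Finset.sum_Ico_add' f 0 m 1]
  rfl

theorem equivNoise_eq_sum (N : RelayNetwork L Q nT nR n)
    (F : ∀ q : ℕ, Matrix (Fin (n q)) (Fin (n q)) ℂ) (l : Fin L) :
    N.equivNoise F l = ∑ q ∈ Finset.range (Q + 1), N.noisePart F q l := by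
  rw [Finset.sum_range_succ, noisePart_self, equivNoise, sum_Icc_one_eq_sum_range]
  congr 1
  refine Finset.sum_congr rfl fun q hq => ?_
  rw [noisePart, if_neg (Finset.mem_range.1 hq).ne]

theorem equivConstraint_eq_sum (N : RelayNetwork L Q nT nR n)
    (F : ∀ q : ℕ, Matrix (Fin (n q)) (Fin (n q)) ℂ) (l : Fin L) :
    N.equivConstraint F l = ∑ q ∈ Finset.range (Q + 1), N.constraintPart F q l := by
  rw [Finset.sum_range_succ', constraintPart_zero, equivConstraint, sum_Icc_one_eq_sum_range]
  rfl

theorem noisePart_posSemidef (hN : N.Nonsingular) {q : ℕ} (hq : q ≤ Q) (l : Fin L) :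
    (N.noisePart F q l).PosSemidef := by
  rcases hq.eq_or_lt with rfl | hq
  · rw [noisePart_self]
    exact (hN.WD l).posSemidef
  · rw [noisePart_of_lt N F hq]
    exact (hN.W (q + 1) (by lia) (by lia)).posSemidef.mul_mul_conjTranspose_same _

theorem equivNoise_posDef (hN : N.Nonsingular) (l : Fin L) : (N.equivNoise F l).PosDef := by
  rw [equivNoise_eq_sum, Finset.sum_range_succ, noisePart_self]
  exact Matrix.PosDef.posSemidef_add (Matrix.posSemidef_sum _ fun q hq =>
    noisePart_posSemidef hN (Finset.mem_range.1 hq).le l) (hN.WD l)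

theorem endToEnd_eq_mul (N : RelayNetwork L Q nT nR n)
    (F : ∀ q : ℕ, Matrix (Fin (n q)) (Fin (n q)) ℂ) {q : ℕ} (hq : q < Q) (l k : Fin L) :
    ∃ Y : Matrix (Fin (n (q + 1))) (Fin (nT k)) ℂ, N.endToEnd F l k = N.HQ l * N.B F (q + 1) Q * Y := by
  rcases Nat.eq_zero_or_pos q with rfl | hq0
  · exact ⟨N.H0 k, rfl⟩
  · refine ⟨N.H q * N.B F 1 q * N.H0 k, ?_⟩
    rw [endToEnd, B_eq_mul N F hq0 hq]
    simp only [Matrix.mul_assoc]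

theorem endToEnd_eq_mul' (N : RelayNetwork L Q nT nR n)
    (F : ∀ q : ℕ, Matrix (Fin (n q)) (Fin (n q)) ℂ) {q : ℕ} (hq : 1 ≤ q) (hqQ : q ≤ Q)
    (l k : Fin L) :
    ∃ Z : Matrix (Fin (nR l)) (Fin (n q)) ℂ, N.endToEnd F l k = Z * (N.B F 1 q * N.H0 k) := by
  rcases hqQ.eq_or_lt with rfl | hqQ
  · exact ⟨N.HQ l, Matrix.mul_assoc _ _ _⟩
  · refine ⟨N.HQ l * N.B F (q + 1) Q * N.H q, ?_⟩
    rw [endToEnd, B_eq_mul N F hq hqQ]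
    simp only [Matrix.mul_assoc]

/-- Noise entering at cluster `q + 1` shares its path to the destination with the signal. A filter
blind to that path would also be blind to its own stream, contradicting `recv_dotProduct_ne_zero`.
-/
theorem nVec_pos (hN : N.Nonsingular) {q : ℕ} (hq : q ≤ Q) {x : S.Idx}
    (hr : (N.equivNetwork F).recv S α x ≠ 0) : 0 < N.nVec F S α q x := by
  change 0 < quadForm _ _
  rcases hq.eq_or_lt with rfl | hq
  · rw [noisePart_self]
    exact quadForm_pos (hN.WD x.1) hr
  · rw [noisePart_of_lt N F hq, quadForm_conjTranspose]
    refine quadForm_pos (hN.W (q + 1) (by lia) (by lia)) fun h0 => ?_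
    obtain ⟨Y, hY⟩ := endToEnd_eq_mul N F hq x.1 x.1
    refine InterferenceNetwork.recv_dotProduct_ne_zero (G := N.equivNetwork F)
      (equivNoise_posDef hN) (coupling_nonneg N F) hr ?_
    change _ ⬝ᵥ (N.endToEnd F x.1 x.1 *ᵥ _) = 0
    have h1 : star ((N.equivNetwork F).recv S α x) ᵥ* (N.HQ x.1 * N.B F (q + 1) Q) = 0 := by
      have := congrArg star h0
      rwa [Matrix.star_mulVec, Matrix.conjTranspose_conjTranspose, star_zero] at this
    rw [hY, ← Matrix.mulVec_mulVec, Matrix.dotProduct_mulVec, h1, zero_dotProduct]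

/-- A stream that vanishes at cluster `q` never reaches its destination, and its receive vector
would be zero. -/
theorem nhatVec_pos (hN : N.Nonsingular) {q : ℕ} (hq : q ≤ Q) {x : S.Idx}
    (hr : (N.equivNetwork F).recv S α x ≠ 0) : 0 < N.nhatVec F S q x := by
  change 0 < quadForm _ _
  rcases Nat.eq_zero_or_pos q with rfl | hq0
  · rw [constraintPart_zero]
    exact quadForm_pos (hN.Wh0 x.1) (S.t_ne_zero x)
  · rw [constraintPart_of_pos N F hq0, quadForm_conj]
    refine quadForm_pos (hN.Wh q hq0 hq) fun h0 => ?_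
    obtain ⟨Z, hZ⟩ := endToEnd_eq_mul' N F hq0 hq x.1 x.1
    refine InterferenceNetwork.channel_mulVec_ne_zero hr ?_
    change N.endToEnd F x.1 x.1 *ᵥ _ = 0
    rw [hZ, ← Matrix.mulVec_mulVec, h0, Matrix.mulVec_zero]

theorem b_nonneg (hN : N.Nonsingular) {q q' : ℕ} (hq : 1 ≤ q) (hqq : q ≤ q') (hq' : q' ≤ Q) :
    0 ≤ N.b F q q' :=
  trace_mul_nonneg ((hN.W q hq (hqq.trans hq')).posSemidef.mul_mul_conjTranspose_same _)
    (hN.Wh q' (hq.trans hqq) hq').posSemidef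

theorem a_pos (hN : N.Nonsingular) [Nonempty S.Idx]
    (hr : ∀ x, (N.equivNetwork F).recv S α x ≠ 0) {q q' : ℕ} (hq : q ≤ Q) (hq' : q' ≤ Q) :
    0 < N.a F S α q q' :=
  dotProduct_mulVec_pos_of_nonneg
    (Matrix.isUnit_nonsing_inv_iff.2 <| InterferenceNetwork.isUnit_reverseMatrix
      (G := N.equivNetwork F) (equivNoise_posDef hN) (coupling_nonneg N F) hr)
    (InterferenceNetwork.inv_reverseMatrix_nonneg (G := N.equivNetwork F)
      (equivNoise_posDef hN) (coupling_nonneg N F) hr)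
    (fun x => nVec_pos hN hq (hr x)) (fun x => nhatVec_pos hN hq' (hr x))

theorem sum_nVec (x : S.Idx) :
    ∑ q ∈ Finset.range (Q + 1), N.nVec F S α q x
      = quadForm ((N.equivNetwork F).W x.1) ((N.equivNetwork F).recv S α x) := by
  change ∑ q ∈ Finset.range (Q + 1), quadForm _ _ = quadForm (N.equivNoise F x.1) _
  rw [equivNoise_eq_sum, quadForm_sum]

/-- The parts `n_q` sum to the noise vector of the equivalent network, so duality applies with `u =
n̂_{q'}`. -/
theorem sum_a (hN : N.Nonsingular) (hr : ∀ x, (N.equivNetwork F).recv S α x ≠ 0) (q' : ℕ) :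
    ∑ q ∈ Finset.range (Q + 1), N.a F S α q q'
      = ∑ x : S.Idx, S.p x.1 x.2 * N.nhatVec F S q' x := by
  have h := InterferenceNetwork.noise_dotProduct_inv_reverseMatrix (G := N.equivNetwork F)
    (equivNoise_posDef hN) (coupling_nonneg N F) hr (N.nhatVec F S q')
  simp only [← sum_nVec] at h
  refine Eq.trans ?_ h
  simp only [a, dotProduct, Finset.sum_mul]
  exact Finset.sum_comm

/-- The cost splits into the signal share, stream by stream, and the noise forwarded from clusters
`1, …, q`; the latter is empty for `q = 0`. -/
theorem txCost_eq (S : StreamDecomposition cov) (q : ℕ) :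
    N.txCost F cov q = (∑ x : S.Idx, S.p x.1 x.2 * N.nhatVec F S q x)
      + ∑ k ∈ Finset.range q, N.b F (k + 1) q := by
  change _ = (∑ x : S.Idx, S.p x.1 x.2 * quadForm (N.constraintPart F q x.1) (S.t x.1 x.2)) + _
  rw [← S.sum_trace_cov_mul]
  cases q with
  | zero => simp [txCost, constraintPart_zero]
  | succ q =>
    rw [txCost, relayCov, sum_Icc_one_eq_sum_range, Matrix.add_mul, Matrix.trace_add,
      Complex.add_re, Finset.sum_mul, Finset.sum_mul, Matrix.trace_sum, Matrix.trace_sum,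
      Complex.re_sum, Complex.re_sum]
    congr 1
    refine Finset.sum_congr rfl fun l _ => ?_
    rw [constraintPart_of_pos N F (by lia), ← Matrix.mul_assoc (cov l),
      Matrix.trace_mul_comm _ (N.B F 1 (q + 1) * N.H0 l), Matrix.conjTranspose_mul]
    simp only [Matrix.mul_assoc]

theorem txCost_pos (hN : N.Nonsingular) [Nonempty S.Idx]
    (hr : ∀ x, (N.equivNetwork F).recv S α x ≠ 0) {q : ℕ} (hq : q ≤ Q) :
    0 < N.txCost F cov q := by
  rw [txCost_eq S]
  refine add_pos_of_pos_of_nonneg (Finset.sum_pos (fun x _ =>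
    mul_pos (S.p_pos x.1 x.2) (nhatVec_pos hN hq (hr x))) Finset.univ_nonempty)
    (Finset.sum_nonneg fun k hk => ?_)
  have := Finset.mem_range.1 hk
  exact b_nonneg hN (by lia) (by lia) hq

theorem txCost_mul_A {i j : Fin (Q + 1)} (hi : 0 < N.txCost F cov i) :
    N.txCost F cov i * N.A F S α i j
      = N.a F S α i j + if (i : ℕ) < j then N.b F (i + 1) j else 0 := by
  rw [A, Matrix.of_apply]
  simp only [Fin.lt_def]
  split_ifs
  · exact mul_div_cancel₀ _ hi.ne'
  · rw [add_zero]
    exact mul_div_cancel₀ _ hi.ne'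

/-- The terms `a` alone are strictly positive, so no irreducibility argument is needed for Perron's
theorem. -/
theorem A_pos (hN : N.Nonsingular) [Nonempty S.Idx]
    (hr : ∀ x, (N.equivNetwork F).recv S α x ≠ 0) (i j : Fin (Q + 1)) :
    0 < N.A F S α i j := by
  have hi := txCost_pos (F := F) hN hr i.is_le
  refine pos_of_mul_pos_right ?_ hi.le
  rw [txCost_mul_A hi]
  refine add_pos_of_pos_of_nonneg (a_pos hN hr i.is_le j.is_le) ?_
  split_ifs with h
  exacts [b_nonneg hN (by lia) h j.is_le, le_rfl]

theorem sum_range_ite_lt {β : Type*} [AddCommMonoid β] (f : ℕ → β) {j m : ℕ} (hj : j ≤ m) :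
    (∑ i ∈ Finset.range m, if i < j then f i else 0) = ∑ i ∈ Finset.range j, f i := by
  rw [← Finset.sum_filter]
  refine Finset.sum_congr ?_ fun _ _ => rfl
  ext i
  simp only [Finset.mem_filter, Finset.mem_range]
  lia

/-- Once the denominators cancel, column `j` collects `∑ i, a i j` and the `b` terms with `i < j`:
the two shares of the cost in `txCost_eq`. -/
theorem txCost_vecMul_A (hN : N.Nonsingular) [Nonempty S.Idx]
    (hr : ∀ x, (N.equivNetwork F).recv S α x ≠ 0) :
    (fun i : Fin (Q + 1) => N.txCost F cov i) ᵥ* N.A F S α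
      = fun i : Fin (Q + 1) => N.txCost F cov i := by
  funext j
  have h : ∀ i : Fin (Q + 1), _ := fun i =>
    txCost_mul_A (S := S) (α := α) (j := j) (txCost_pos (F := F) hN hr i.is_le)
  rw [Matrix.vecMul, dotProduct, Finset.sum_congr rfl fun i _ => h i,
    Fin.sum_univ_eq_sum_range (fun i => N.a F S α i j + if i < (j : ℕ) then N.b F (i + 1) j else 0),
    Finset.sum_add_distrib, sum_a hN hr, sum_range_ite_lt _ j.is_lt.le, txCost_eq S]

/-! ### Costs in the scaled dual network as linear functions of the scaling vector. -/

theorem equivConstraint_scaleDual (d : Fin (Q + 1) → ℝ) (l : Fin L) :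
    (N.scaleDual d).equivConstraint F l
      = ∑ j : Fin (Q + 1), d j • N.constraintPart F j l := by
  rw [equivConstraint_eq_sum, ← Fin.sum_univ_eq_sum_range]
  refine Finset.sum_congr rfl fun j _ => ?_
  rcases Nat.eq_zero_or_pos (j : ℕ) with h0 | h0
  · rw [h0, constraintPart_zero, constraintPart_zero, (Fin.ext h0 : j = 0)]
    rfl
  · have hB : (N.scaleDual d).B F = N.B F := rfl
    -- The index is at most `Q`, so the unscaled default branch of `scaleDual` is not reached.
    have hW : (N.scaleDual d).Wh j = d j • N.Wh j := dif_pos j.is_lt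
    rw [constraintPart_of_pos _ F h0, constraintPart_of_pos _ F h0, hB, hW, Matrix.mul_smul,
      Matrix.smul_mul]
    rfl

theorem equivNetwork_scaleDual (d : Fin (Q + 1) → ℝ) :
    (N.scaleDual d).equivNetwork F
      = { N.equivNetwork F with What := (N.scaleDual d).equivConstraint F } :=
  rfl

theorem recv_scaleDual (d : Fin (Q + 1) → ℝ) :
    ((N.scaleDual d).equivNetwork F).recv S α = (N.equivNetwork F).recv S α := by
  rw [equivNetwork_scaleDual, InterferenceNetwork.recv_setConstraint]

theorem reverseMatrix_scaleDual (d : Fin (Q + 1) → ℝ) :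
    ((N.scaleDual d).equivNetwork F).reverseMatrix S α = (N.equivNetwork F).reverseMatrix S α := by
  rw [equivNetwork_scaleDual, InterferenceNetwork.reverseMatrix_setConstraint]

/-- The inverse does not see `d`, and the scaled constraint matrices are linear in `d`. -/
theorem reversePower_scaleDual (d : Fin (Q + 1) → ℝ) :
    ((N.scaleDual d).equivNetwork F).reversePower S α
      = ∑ j : Fin (Q + 1), d j •
          (((N.equivNetwork F).reverseMatrix S α)⁻¹ *ᵥ N.nhatVec F S j) := by
  have h : (fun x : S.Idx => quadForm ((N.scaleDual d).equivConstraint F x.1) (S.t x.1 x.2))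
      = ∑ j : Fin (Q + 1), d j • N.nhatVec F S j := by
    funext x
    rw [equivConstraint_scaleDual, quadForm_sum, Finset.sum_apply]
    exact Finset.sum_congr rfl fun j _ => quadForm_smul _ _ _
  change (((N.scaleDual d).equivNetwork F).reverseMatrix S α)⁻¹ *ᵥ
    (fun x : S.Idx => quadForm ((N.scaleDual d).equivConstraint F x.1) (S.t x.1 x.2)) = _
  rw [h, reverseMatrix_scaleDual, Matrix.mulVec_sum]
  simp only [Matrix.mulVec_smul]

theorem sum_trace_scaledCovTransform (d : Fin (Q + 1) → ℝ) (q : ℕ) :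
    ∑ l, (N.scaledCovTransform F S α d l * N.noisePart F q l).trace.re
      = ∑ j : Fin (Q + 1), N.a F S α q j * d j := by
  unfold scaledCovTransform
  rw [InterferenceNetwork.sum_trace_covTransform_mul (N.noisePart F q), recv_scaleDual]
  change ((N.scaleDual d).equivNetwork F).reversePower S α ⬝ᵥ N.nVec F S α q = _
  rw [reversePower_scaleDual, dotProduct_comm, dotProduct_sum]
  refine Finset.sum_congr rfl fun j _ => ?_
  rw [dotProduct_smul, smul_eq_mul, mul_comm]
  rfl

theorem dualSourceCost_eq (d : Fin (Q + 1) → ℝ) :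
    (N.scaleDual d).dualSourceCost (N.scaledCovTransform F S α d)
      = ∑ j : Fin (Q + 1), N.a F S α Q j * d j := by
  rw [← sum_trace_scaledCovTransform]
  simp only [noisePart_self]
  rfl

/-- The dual signal share gives the `a` terms by `sum_trace_scaledCovTransform`. The dual noise of
cluster `j`, scaled by `d j`, gives the `b` terms after a cyclic shift of the trace. -/
theorem dualRelayCost_eq (d : Fin (Q + 1) → ℝ) (q : Fin Q) :
    (N.scaleDual d).dualRelayCost (fun k => (F k)ᴴ) (N.scaledCovTransform F S α d) (q + 1)
      = ∑ j : Fin (Q + 1),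
          (N.a F S α q j + if (q : ℕ) < j then N.b F (q + 1) j else 0) * d j := by
  -- `dualB` conjugate-transposes the dual precoders once more, recovering the forward chain.
  have hB : (N.scaleDual d).dualB (fun k => (F k)ᴴ) = N.B F := by
    have : (fun k => ((F k)ᴴ)ᴴ) = F := by simp
    unfold dualB
    rw [this]
    rfl
  have hH : (N.scaleDual d).HQ = N.HQ := rfl
  have hW : (N.scaleDual d).W = N.W := rfl
  rw [dualRelayCost, dualRelayCov, hB, hH, hW, Matrix.add_mul, Matrix.trace_add, Complex.add_re,
    Finset.sum_mul, Finset.sum_mul, Matrix.trace_sum, Matrix.trace_sum, Complex.re_sum,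
    Complex.re_sum]
  simp only [add_mul, Finset.sum_add_distrib]
  congr 1
  · rw [← sum_trace_scaledCovTransform]
    refine Finset.sum_congr rfl fun l _ => ?_
    rw [noisePart_of_lt N F q.is_lt, ← Matrix.mul_assoc, ← Matrix.mul_assoc,
      Matrix.trace_mul_comm _ (N.HQ l * N.B F (q + 1) Q)ᴴ, Matrix.conjTranspose_mul]
    simp only [Matrix.mul_assoc]
  -- Clusters `q + 1, …, Q` are the column indices `j > q`, matching the strict upper triangle of
  -- `A`.
  · have hIcc : Finset.Icc ((q : ℕ) + 1) Q
        = (Finset.range (Q + 1)).filter fun k => (q : ℕ) < k := by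
      ext k
      simp only [Finset.mem_Icc, Finset.mem_filter, Finset.mem_range]
      lia
    rw [hIcc, Finset.sum_filter, ← Fin.sum_univ_eq_sum_range]
    refine Finset.sum_congr rfl fun j _ => ?_
    split_ifs
    · have hWh : (N.scaleDual d).Wh j = d j • N.Wh j := dif_pos j.is_lt
      rw [hWh, Matrix.mul_smul, Matrix.smul_mul, Matrix.smul_mul, Matrix.trace_smul,
        Complex.smul_re, smul_eq_mul, mul_comm, b, Matrix.mul_assoc (_ * _) _ (N.W (q + 1)),
        Matrix.trace_mul_comm (_ * _), ← Matrix.mul_assoc]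
    · rw [zero_mul]

end RelayNetwork

/-! ### The dual scaling theorem. -/

theorem mainTheorem3 {L Q : ℕ} (hQ : 1 ≤ Q) {nT nR : Fin L → ℕ} {n : ℕ → ℕ}
    (N : RelayNetwork L Q nT nR n) (hN : N.Nonsingular)
    (F : ∀ q : ℕ, Matrix (Fin (n q)) (Fin (n q)) ℂ)
    (cov : ∀ l : Fin L, Matrix (Fin (nT l)) (Fin (nT l)) ℂ) (hcov : ∃ l, cov l ≠ 0)
    (S : StreamDecomposition cov) (α : S.Idx → ℂ)
    (hα : ∀ x : S.Idx, ‖WithLp.toLp 2 ((N.equivNetwork F).recv S α x)‖ = 1) :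
    -- the quantities that enter the matrix are well defined, and the matrix is nonnegative
    IsUnit ((N.equivNetwork F).sinrMatrix S α) ∧
    IsUnit ((N.equivNetwork F).reverseMatrix S α) ∧
    (∀ q : Fin (Q + 1), 0 < N.txCost F cov q) ∧
    (∀ i j, 0 ≤ N.A F S α i j) ∧
    -- the maximal eigenvalue and the dominant eigenvector, with last entry normalized to one
    ∃ (lam : ℝ) (d : Fin (Q + 1) → ℝ),
      IsMaxEigenvalue (N.A F S α) lam ∧
      0 < lam ∧
      N.A F S α *ᵥ d = lam • d ∧
      (∀ i, 0 < d i) ∧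
      d (Fin.last Q) = 1 ∧
      (∀ v : Fin (Q + 1) → ℝ, N.A F S α *ᵥ v = lam • v → ∃ c : ℝ, v = c • d) ∧
      lam = 1 ∧
      -- the per-hop costs in the scaled dual network
      (N.scaleDual d).dualSourceCost (N.scaledCovTransform F S α d) = N.txCost F cov Q ∧
      (∀ q : Fin Q,
        (N.scaleDual d).dualRelayCost (fun k => (F k)ᴴ) (N.scaledCovTransform F S α d) (q + 1)
          = d q.castSucc * N.txCost F cov q) ∧
      -- the resulting bounds under a per-hop linear constraint
      (∀ P : Fin (Q + 1) → ℝ, N.PerHopConstraint F cov P →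
        (N.scaleDual d).dualSourceCost (N.scaledCovTransform F S α d) ≤ P (Fin.last Q) ∧
        ∀ q : Fin Q,
          (N.scaleDual d).dualRelayCost (fun k => (F k)ᴴ) (N.scaledCovTransform F S α d) (q + 1)
            ≤ d q.castSucc * P q.castSucc) := by
  have hr : ∀ x, (N.equivNetwork F).recv S α x ≠ 0 := fun x h => by
    have := hα x
    rw [h] at this
    simp at this
  have := S.nonempty_idx hcov
  have hW : ∀ l, ((N.equivNetwork F).W l).PosDef := RelayNetwork.equivNoise_posDef hN
  have hΦ := RelayNetwork.coupling_nonneg N F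
  have hP : ∀ q : Fin (Q + 1), 0 < N.txCost F cov q := fun q =>
    RelayNetwork.txCost_pos hN hr q.is_le
  have hA := RelayNetwork.A_pos hN hr
  have hPA := RelayNetwork.txCost_vecMul_A hN hr
  obtain ⟨d, hd, hdpos, hdQ, huniq⟩ := exists_perron_vector hA hP hPA (Fin.last Q)
  -- Row `i` of `A d = d`, multiplied by the cost that divides that row of `A`.
  have hrow : ∀ i : Fin (Q + 1),
      ∑ j : Fin (Q + 1), (N.a F S α i j + if (i : ℕ) < j then N.b F (i + 1) j else 0) * d j
        = d i * N.txCost F cov i := fun i => by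
    conv_rhs => rw [← hd, mul_comm, Matrix.mulVec, dotProduct, Finset.mul_sum]
    exact Finset.sum_congr rfl fun j _ => by rw [← mul_assoc, RelayNetwork.txCost_mul_A (hP i)]
  have hsource : (N.scaleDual d).dualSourceCost (N.scaledCovTransform F S α d)
      = N.txCost F cov Q := by
    have h := hrow (Fin.last Q)
    rw [hdQ, one_mul, Fin.val_last] at h
    rw [← h, RelayNetwork.dualSourceCost_eq]
    refine Finset.sum_congr rfl fun j _ => ?_
    -- The last row has no entry to the right of the diagonal, hence no `b` term: the dual sources
    -- forward no relay noise.
    rw [if_neg j.is_le.not_gt, add_zero]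
  have hrelay : ∀ q : Fin Q,
      (N.scaleDual d).dualRelayCost (fun k => (F k)ᴴ) (N.scaledCovTransform F S α d) (q + 1)
        = d q.castSucc * N.txCost F cov q := fun q =>
    (RelayNetwork.dualRelayCost_eq d q).trans (hrow q.castSucc)
  refine ⟨InterferenceNetwork.isUnit_sinrMatrix hW hΦ hr,
    InterferenceNetwork.isUnit_reverseMatrix hW hΦ hr, hP, fun i j => (hA i j).le, 1, d,
    isMaxEigenvalue_one (fun i j => (hA i j).le) hP hPA
      (fun h => (hdpos 0).ne' (congrFun h 0)) hd,
    one_pos, by rw [hd, one_smul], hdpos, hdQ, fun v hv => huniq v (by rwa [one_smul] at hv), rfl,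
    hsource, hrelay, fun P hPP => ⟨?_, fun q => ?_⟩⟩
  · rw [hsource]
    exact hPP (Fin.last Q)
  · rw [hrelay]
    exact mul_le_mul_of_nonneg_left (hPP q.castSucc) (hdpos _).le
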